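/- Let $X$ be a non-empty complete CAT(0) space, let $k_1,\dots,k_n$ be positive integers, and suppose that the (Lebesgue covering) dimension of $X$ is less than $k_1+\dots+k_n$. Let $S_1,\dots,S_n$ be subsets of the isometry group $\mathrm{Isom}(X)$ such that $st=ts$ whenever $s\in S_i$, $t\in S_j$ and $i\neq j$. Suppose that, for every $i=1,\dots,n$, every subset of $S_i$ with at most $k_i$ elements has a common fixed point in $X$ (if $S_i$ has at least $k_i$ elements, this says that every $k_i$-element subset of $S_i$ has a common fixed point in $X$). Then there is an $i\in\{1,\dots,n\}$ such that every finite subset of $S_i$ has a common fixed point in $X$. -/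

import Mathlib

/-- A metric space is CAT(0) if it is geodesic and every geodesic triangle is at least as thin as
its comparison triangle in the Euclidean plane: if `p` and `q` lie on sides `[x, y]` and `[x, z]`
of a geodesic triangle and `p'`, `q'` are the corresponding points of a comparison triangle
`x' y' z'`, then `dist p q ≤ dist p' q'`.

In a geodesic space a point `p` lies on some geodesic segment from `x` to `y` if and only if
`dist x p + dist p y = dist x y`. The vertex `x` is arbitrary, so all pairs of distinct sides are
covered; two points on one and the same side satisfy the inequality trivially. -/
class IsCAT0 (X : Type*) [MetricSpace X] : Prop where
  exists_geodesic : ∀ x y : X, ∃ γ : ℝ → X, γ 0 = x ∧ γ (dist x y) = y ∧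
    ∀ s ∈ Set.Icc 0 (dist x y), ∀ t ∈ Set.Icc 0 (dist x y), dist (γ s) (γ t) = |s - t|
  dist_le_comparison : ∀ (x y z p q : X) (x' y' z' p' q' : EuclideanSpace ℝ (Fin 2)),
    dist x' y' = dist x y → dist y' z' = dist y z → dist x' z' = dist x z →
    dist x p + dist p y = dist x y → dist x q + dist q z = dist x z →
    dist x' p' = dist x p → dist p' y' = dist p y →
    dist x' q' = dist x q → dist q' z' = dist q z →
    dist p q ≤ dist p' q'

/-- Lebesgue covering dimension less than `n`: every finite open cover of `X` has an open
refinement such that every point lies in at most `n` of its members. -/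
def HasCoveringDimLT (X : Type*) [TopologicalSpace X] (n : ℕ) : Prop :=
  ∀ 𝒰 : Set (Set X), 𝒰.Finite → (∀ U ∈ 𝒰, IsOpen U) → ⋃₀ 𝒰 = Set.univ →
    ∃ 𝒱 : Set (Set X), (∀ V ∈ 𝒱, IsOpen V) ∧ ⋃₀ 𝒱 = Set.univ ∧
      (∀ V ∈ 𝒱, ∃ U ∈ 𝒰, V ⊆ U) ∧ ∀ x : X, {V ∈ 𝒱 | x ∈ V}.encard ≤ n

/-- The Lebesgue covering dimension of a topological space, equal to `⊥` for the empty space and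
to `⊤` for a space of infinite dimension. -/
noncomputable def coveringDim (X : Type*) [TopologicalSpace X] : WithBot ℕ∞ :=
  sInf {d | ∀ n : ℕ, d < n → HasCoveringDimLT X n}

theorem HasCoveringDimLT.mono {X : Type*} [TopologicalSpace X] {m n : ℕ} (hmn : m ≤ n)
    (h : HasCoveringDimLT X m) : HasCoveringDimLT X n := by
  intro 𝒰 h1 h2 h3
  obtain ⟨𝒱, h4, h5, h6, h7⟩ := h 𝒰 h1 h2 h3
  exact ⟨𝒱, h4, h5, h6, fun x => (h7 x).trans (by exact_mod_cast hmn)⟩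

theorem coveringDim_lt_iff {X : Type*} [TopologicalSpace X] {n : ℕ} :
    coveringDim X < n ↔ HasCoveringDimLT X n := by
  constructor
  · intro h
    obtain ⟨d, hd, hdn⟩ := sInf_lt_iff.1 h
    exact hd n hdn
  · intro h
    cases n with
    | zero =>
      have : coveringDim X ≤ ⊥ := sInf_le fun m _ => h.mono (Nat.zero_le m)
      exact this.trans_lt (WithBot.bot_lt_coe _)
    | succ n =>
      have : coveringDim X ≤ (n : WithBot ℕ∞) := sInf_le fun m hm => h.mono (by
        have : n < m := by exact_mod_cast hm
        omega)
      exact this.trans_lt (by exact_mod_cast n.lt_succ_self)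

/-!
Suppose that every `S i` contains a finite set without a common fixed point, and let `T i` be a
minimal one. It has more than `k i` elements, and for each `s ∈ T i` the isometries in `T i \ {s}`
have a common fixed point. By commutation, nearest point projections onto fixed sets turn these
into points `x J`, one for each choice `J` of an element of every `T i`, fixed by all other elements
of all `T i` (`exists_common_fixedPoint`). The fixed sets are convex, so the points `x J` span a map
to `X` of the product of the simplices with vertex sets `T i`, which sends the facet opposite to
`s ∈ T i` into the fixed set of `s`.

Distinguish `τ i ∈ T i`. The sets `{x | s x ≠ x}` for `s ∈ T i \ {τ i}`, together with the single
set `⋂ i, {x | τ i x ≠ x}`, form an open cover of `X` with `∑ i, (#(T i) - 1) + 1 > ∑ i, k i`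
members. Precomposing with a map of a simplex with as many vertices to the product of simplices
gives a map that sends each facet into the complement of the corresponding member of the cover
(`exists_continuous_simplex_of_product`). In a refinement of this cover, let `O l` be the union of
the members assigned to the `l`-th member of the cover. By the Knaster–Kuratowski–Mazurkiewicz
theorem (`exists_mem_stdSimplex_forall_mem`), applied to the preimages of the complements, all the
`O l` have a common point, so the refinement has multiplicity greater than `∑ i, k i`
(`not_hasCoveringDimLT_of_continuous`), contrary to the hypothesis on the dimension.

The Knaster–Kuratowski–Mazurkiewicz theorem is derived by a limit argument from a combinatorial
lemma of Scarf (`exists_isDominant_forall_label`), a form of Sperner's lemma in which linear orders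
replace triangulations.
-/

/-! ### A combinatorial lemma of Scarf -/

/-- A finite set `Y` is dominant for the rankings `r i` if no element beats, in every ranking, the
lowest ranked element of `Y`. -/
def IsDominant {ι W : Type*} (r : ι → W → ℕ) (Y : Finset W) : Prop :=
  ∀ t, ∃ i, ∀ y ∈ Y, r i t ≤ r i y

theorem IsDominant.subset {ι W : Type*} {r : ι → W → ℕ} {Y Z : Finset W} (hY : IsDominant r Y)
    (hZ : Z ⊆ Y) : IsDominant r Z := fun t => by
  obtain ⟨i, hi⟩ := hY t
  exact ⟨i, fun y hy => hi y (hZ hy)⟩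

theorem IsDominant.exists_eq_of_isLeast {ι W : Type*} {r : ι → W → ℕ}
    (hr : ∀ i, Function.Injective (r i)) {Y : Finset W} (hY : IsDominant r Y) {m : ι → W}
    (hm : ∀ i, m i ∈ Y ∧ ∀ y ∈ Y, r i (m i) ≤ r i y) {y : W} (hy : y ∈ Y) : ∃ i, m i = y := by
  obtain ⟨i, hi⟩ := hY y
  exact ⟨i, hr i (le_antisymm ((hm i).2 y hy) (hi _ (hm i).1))⟩

/-- The replacement step: a dominant set `Z` of size `|ι| - 1` extends to a dominant set of size
`|ι|` in exactly two ways, unless the rankings leave no room for one of the extensions, which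
`hroom` rules out. The lowest ranked elements of `Z` coincide for exactly two rankings `i` and `j`;
each of them gives one extension, by the `i`-highest element exceeding the minimum of `Z` in all
rankings but the `i`-th. -/
theorem IsDominant.exists_pair_insert {ι W : Type*} [Fintype ι] [Fintype W] [DecidableEq W]
    {r : ι → W → ℕ} (hr : ∀ i, Function.Injective (r i)) {Z : Finset W} (hZ : IsDominant r Z)
    (hcard : Z.card + 1 = Fintype.card ι) (hne : Z.Nonempty)
    (hroom : ∀ k, ∃ t, ∀ c ≠ k, ∃ z ∈ Z, r c z < r c t) :
    ∃ w₁ w₂, w₁ ≠ w₂ ∧ ∀ w, (w ∉ Z ∧ IsDominant r (insert w Z)) ↔ w = w₁ ∨ w = w₂ := by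
  classical
  choose m hm using fun i => Finset.exists_min_image Z (r i) hne
  have hsurj : ∀ z ∈ Z, ∃ i, m i = z := fun z hz => hZ.exists_eq_of_isLeast hr hm hz
  obtain ⟨i, -, j, -, hij, hmij⟩ := Finset.exists_ne_map_eq_of_card_lt_of_maps_to
    (s := (Finset.univ : Finset ι)) (t := Z) (f := m)
    (by rw [Finset.card_univ]; omega) (fun i _ => (hm i).1)
  let M : ι → Finset W := fun k => Finset.univ.filter fun t => ∀ c ≠ k, r c (m c) < r c t
  have hM : ∀ k t, t ∈ M k ↔ ∀ c ≠ k, r c (m c) < r c t := fun k t => by simp [M]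
  have hMne : ∀ k, (M k).Nonempty := fun k => by
    obtain ⟨t, ht⟩ := hroom k
    refine ⟨t, (hM k t).2 fun c hc => ?_⟩
    obtain ⟨z, hz, hzt⟩ := ht c hc
    exact ((hm c).2 z hz).trans_lt hzt
  choose w hwM hw using fun k => Finset.exists_max_image (M k) (r k) (hMne k)
  -- an element exceeding all minima but the `k`-th lies below the `k`-th one
  have hlow : ∀ k, ∀ t ∈ M k, r k t ≤ r k (m k) := fun k t ht => by
    obtain ⟨c, hc⟩ := hZ t
    by_cases hck : c = k
    · subst hck; exact hc _ (hm c).1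
    · exact absurd ((hM k t).1 ht c hck) (not_lt.2 (hc _ (hm c).1))
  have hsurj' : ∀ k, (k = i ∨ k = j) → ∀ z ∈ Z, ∃ c ≠ k, m c = z := by
    rintro k hk z hz
    obtain ⟨c, rfl⟩ := hsurj z hz
    by_cases hck : c = k
    · rcases hk with rfl | rfl
      · exact ⟨j, hij.symm, by rw [hck, hmij]⟩
      · exact ⟨i, hij, by rw [hck, hmij]⟩
    · exact ⟨c, hck, rfl⟩
  have hgood : ∀ k, (k = i ∨ k = j) → w k ∉ Z ∧ IsDominant r (insert (w k) Z) := by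
    intro k hk
    refine ⟨fun hwZ => ?_, fun t => ?_⟩
    · obtain ⟨c, hck, hc⟩ := hsurj' k hk _ hwZ
      exact absurd ((hM k _).1 (hwM k) c hck) (by rw [hc]; exact lt_irrefl _)
    · by_cases ht : t ∈ M k
      · refine ⟨k, fun y hy => ?_⟩
        rcases Finset.mem_insert.1 hy with rfl | hy
        · exact hw k t ht
        · exact (hlow k t ht).trans ((hm k).2 y hy)
      · rw [hM] at ht
        push Not at ht
        obtain ⟨c, hck, hc⟩ := ht
        refine ⟨c, fun y hy => ?_⟩
        rcases Finset.mem_insert.1 hy with rfl | hy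
        · exact hc.trans ((hM k _).1 (hwM k) c hck).le
        · exact hc.trans ((hm c).2 y hy)
  refine ⟨w i, w j, fun h => ?_, fun v => ⟨?_, ?_⟩⟩
  · have h1 := hlow i _ (hwM i)
    have h2 := (hM j _).1 (hwM j) i hij
    rw [h] at h1
    omega
  · rintro ⟨hvZ, hv⟩
    let m' : ι → W := fun c => if r c v < r c (m c) then v else m c
    have hm' : ∀ c, m' c ∈ insert v Z ∧ ∀ y ∈ insert v Z, r c (m' c) ≤ r c y := by
      intro c
      by_cases hc : r c v < r c (m c)
      · simp only [m', if_pos hc]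
        refine ⟨Finset.mem_insert_self _ _, fun y hy => ?_⟩
        rcases Finset.mem_insert.1 hy with rfl | hy
        · exact le_rfl
        · exact hc.le.trans ((hm c).2 y hy)
      · simp only [m', if_neg hc]
        refine ⟨Finset.mem_insert_of_mem (hm c).1, fun y hy => ?_⟩
        rcases Finset.mem_insert.1 hy with rfl | hy
        · exact not_lt.1 hc
        · exact (hm c).2 y hy
    have hinj : Function.Injective m' := by
      have : Finset.image m' Finset.univ = insert v Z := by
        ext y
        simp only [Finset.mem_image, Finset.mem_univ, true_and]
        constructor
        · rintro ⟨c, rfl⟩; exact (hm' c).1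
        · exact fun hy => hv.exists_eq_of_isLeast hr hm' hy
      rw [← Set.injOn_univ, ← Finset.coe_univ, ← Finset.card_image_iff, this,
        Finset.card_insert_of_notMem hvZ, hcard, Finset.card_univ]
    obtain ⟨k, hk⟩ := hv.exists_eq_of_isLeast hr hm' (Finset.mem_insert_self v Z)
    have hother : ∀ c ≠ k, r c (m c) < r c v := by
      intro c hck
      have h1 : ¬ r c v < r c (m c) := fun h => hck (hinj (by rw [hk]; simp [m', h]))
      refine lt_of_le_of_ne (not_lt.1 h1) fun h => hvZ ?_
      rw [← hr c h]; exact (hm c).1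
    have hk' : k = i ∨ k = j := by
      by_contra hcon
      push Not at hcon
      refine hij (hinj ?_)
      simp only [m', if_neg (not_lt.2 (hother i hcon.1.symm).le),
        if_neg (not_lt.2 (hother j hcon.2.symm).le), hmij]
    have hvw : v = w k := by
      refine hr k (le_antisymm (hw k v ((hM k v).2 hother)) ?_)
      obtain ⟨c, hc⟩ := hv (w k)
      by_cases hck : c = k
      · subst hck; exact hc v (Finset.mem_insert_self _ _)
      · exact absurd ((hM k _).1 (hwM k) c hck)
          (not_lt.2 (hc _ (Finset.mem_insert_of_mem (hm c).1)))
    rcases hk' with rfl | rfl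
    · exact Or.inl hvw
    · exact Or.inr hvw
  · rintro (rfl | rfl)
    · exact hgood i (Or.inl rfl)
    · exact hgood j (Or.inr rfl)

/-- Scarf's lemma. The elements `Sum.inr i` are slack elements: `Sum.inr i` is ranked below `T` in
the ranking `i` and above `T` in every other one. For every labelling of `T` there is a dominant
set in which all labels occur, `Sum.inr i` being labelled by `i`. The proof fixes a label `i₀` and
counts incidences between dominant sets of size `|ι|` and of size `|ι| - 1` carrying all labels
but possibly `i₀`. If the lemma fails, each set of the first kind contains exactly two of the
second kind, while the only set of the second kind with an odd number of extensions is the one of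
the slack elements `Sum.inr i` with `i ≠ i₀`. -/
theorem exists_isDominant_forall_label {ι T : Type*} [Fintype ι] [Nonempty ι] [Fintype T]
    [Nonempty T] {r : ι → T ⊕ ι → ℕ} (hr : ∀ i, Function.Injective (r i))
    (hlow : ∀ i w, w ≠ Sum.inr i → r i (Sum.inr i) < r i w)
    (hhigh : ∀ i j t, j ≠ i → r i (Sum.inl t) < r i (Sum.inr j)) (lab : T → ι) :
    ∃ Y, IsDominant r Y ∧ ∀ i, ∃ y ∈ Y, Sum.elim lab id y = i := by
  classical
  by_contra hcon
  push Not at hcon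
  obtain ⟨i₀⟩ := ‹Nonempty ι›
  set l : T ⊕ ι → ι := Sum.elim lab id with hl
  let R : Finset (Finset (T ⊕ ι)) := Finset.univ.filter fun Y =>
    Y.card = Fintype.card ι ∧ IsDominant r Y ∧ ∀ i ≠ i₀, ∃ y ∈ Y, l y = i
  let D : Finset (Finset (T ⊕ ι)) := Finset.univ.filter fun Z =>
    Z.card + 1 = Fintype.card ι ∧ IsDominant r Z ∧ ∀ i ≠ i₀, ∃ y ∈ Z, l y = i
  have hR : ∀ Y, Y ∈ R ↔
    Y.card = Fintype.card ι ∧ IsDominant r Y ∧ ∀ i ≠ i₀, ∃ y ∈ Y, l y = i := fun Y => by simp [R]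
  have hD : ∀ Z, Z ∈ D ↔
    Z.card + 1 = Fintype.card ι ∧ IsDominant r Z ∧ ∀ i ≠ i₀, ∃ y ∈ Z, l y = i := fun Z => by
      simp [D]
  have hcount := Finset.sum_card_bipartiteAbove_eq_sum_card_bipartiteBelow
    (s := R) (t := D) (fun Y Z => Z ⊆ Y)
  have hleft : Even (∑ Y ∈ R, (D.bipartiteAbove (fun Y Z => Z ⊆ Y) Y).card) := by
    refine Finset.even_sum _ fun Y hY => ?_
    obtain ⟨hYc, hYd, hYl⟩ := (hR Y).1 hY
    have hi₀ : ∀ y ∈ Y, l y ≠ i₀ := by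
      obtain ⟨i, hi⟩ := hcon Y hYd
      intro y hy hyi
      by_cases h : i = i₀
      · exact hi y hy (hyi.trans h.symm)
      · obtain ⟨y', hy', h'⟩ := hYl i h
        exact hi y' hy' h'
    have hpos : 0 < Fintype.card ι := Fintype.card_pos_iff.2 ⟨i₀⟩
    obtain ⟨a, ha, b, hb, hab, hlab⟩ := Finset.exists_ne_map_eq_of_card_lt_of_maps_to
      (s := Y) (t := Finset.univ.erase i₀) (f := l)
      (by rw [Finset.card_erase_of_mem (Finset.mem_univ _), Finset.card_univ]; omega)
      (fun y hy => by simpa using hi₀ y hy)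
    have herase : ∀ a ∈ Y, ∀ b ∈ Y, a ≠ b → l a = l b → Y.erase a ∈ D := by
      intro a ha b hb hab hlab
      refine (hD _).2 ⟨?_, hYd.subset (Finset.erase_subset _ _), fun i hi => ?_⟩
      · rw [Finset.card_erase_of_mem ha]; omega
      · obtain ⟨y, hy, hyi⟩ := hYl i hi
        by_cases hya : y = a
        · exact ⟨b, Finset.mem_erase.2 ⟨hab.symm, hb⟩, by rw [← hlab, ← hya, hyi]⟩
        · exact ⟨y, Finset.mem_erase.2 ⟨hya, hy⟩, hyi⟩
    have hset : D.bipartiteAbove (fun Y Z => Z ⊆ Y) Y = {Y.erase a, Y.erase b} := by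
      ext Z
      simp only [Finset.mem_bipartiteAbove, Finset.mem_insert, Finset.mem_singleton]
      constructor
      · rintro ⟨hZD, hZY⟩
        obtain ⟨hZc, hZd, hZl⟩ := (hD Z).1 hZD
        obtain ⟨y, hyZ, rfl⟩ := Finset.exists_eq_insert_iff.2 ⟨hZY, by omega⟩
        by_contra hne
        push Not at hne
        have hy : ∀ c ∈ insert y Z, Z ≠ (insert y Z).erase c → c ∈ Z := by
          intro c hc hcne
          rcases Finset.mem_insert.1 hc with rfl | hc
          · exact absurd (Finset.erase_insert hyZ).symm hcne
          · exact hc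
        have haZ := hy a ha hne.1
        have hbZ := hy b hb hne.2
        have h1 : Finset.univ.erase i₀ ⊆ (Z.erase a).image l := by
          intro i hi
          obtain ⟨z, hz, hzi⟩ := hZl i (Finset.ne_of_mem_erase hi)
          by_cases hza : z = a
          · exact Finset.mem_image.2 ⟨b, Finset.mem_erase.2 ⟨hab.symm, hbZ⟩,
              by rw [← hlab, ← hza, hzi]⟩
          · exact Finset.mem_image.2 ⟨z, Finset.mem_erase.2 ⟨hza, hz⟩, hzi⟩
        have h2 := (Finset.card_le_card h1).trans Finset.card_image_le
        rw [Finset.card_erase_of_mem (Finset.mem_univ _), Finset.card_univ,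
          Finset.card_erase_of_mem haZ] at h2
        have := Finset.card_pos.2 ⟨a, haZ⟩
        omega
      · rintro (rfl | rfl)
        · exact ⟨herase a ha b hb hab hlab, Finset.erase_subset _ _⟩
        · exact ⟨herase b hb a ha hab.symm hlab.symm, Finset.erase_subset _ _⟩
    rw [hset, Finset.card_pair]
    · exact even_two
    · intro h
      have : a ∈ Y.erase b := Finset.mem_erase.2 ⟨hab, ha⟩
      rw [← h] at this
      exact Finset.notMem_erase _ _ this
  have hins : ∀ Z ∈ D, ∀ Y,
      Y ∈ R.bipartiteBelow (fun Y Z => Z ⊆ Y) Z ↔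
        ∃ w, (w ∉ Z ∧ IsDominant r (insert w Z)) ∧ insert w Z = Y := by
    intro Z hZ Y
    obtain ⟨hZc, hZd, hZl⟩ := (hD Z).1 hZ
    rw [Finset.mem_bipartiteBelow, hR]
    constructor
    · rintro ⟨⟨hYc, hYd, hYl⟩, hZY⟩
      obtain ⟨w, hw, rfl⟩ := Finset.exists_eq_insert_iff.2 ⟨hZY, by omega⟩
      exact ⟨w, ⟨hw, hYd⟩, rfl⟩
    · rintro ⟨w, ⟨hw, hd⟩, rfl⟩
      refine ⟨⟨by rw [Finset.card_insert_of_notMem hw, hZc], hd, fun i hi => ?_⟩,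
        Finset.subset_insert _ _⟩
      obtain ⟨z, hz, hzi⟩ := hZl i hi
      exact ⟨z, Finset.mem_insert_of_mem hz, hzi⟩
  set Z₀ : Finset (T ⊕ ι) := (Finset.univ.erase i₀).image Sum.inr with hZ₀
  have hmem₀ : ∀ w, w ∈ Z₀ ↔ ∃ c, c ≠ i₀ ∧ Sum.inr c = w := fun w => by simp [hZ₀]
  have hdom₀ : IsDominant r Z₀ := by
    rintro (t | c)
    · refine ⟨i₀, fun y hy => ?_⟩
      obtain ⟨c, hc, rfl⟩ := (hmem₀ _).1 hy
      exact (hhigh _ _ _ hc).le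
    · refine ⟨c, fun y hy => ?_⟩
      by_cases h : y = Sum.inr c
      · rw [h]
      · exact (hlow c y h).le
  have hZ₀D : Z₀ ∈ D := by
    refine (hD _).2 ⟨?_, hdom₀, fun i hi => ⟨Sum.inr i, (hmem₀ _).2 ⟨i, hi, rfl⟩, rfl⟩⟩
    rw [hZ₀, Finset.card_image_of_injective _ Sum.inr_injective,
      Finset.card_erase_of_mem (Finset.mem_univ _), Finset.card_univ]
    have hpos : 0 < Fintype.card ι := Fintype.card_pos_iff.2 ⟨i₀⟩
    omega
  have hright₀ : (R.bipartiteBelow (fun Y Z => Z ⊆ Y) Z₀).card = 1 := by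
    obtain ⟨t, -, ht⟩ := Finset.exists_max_image (Finset.univ : Finset T)
      (fun t => r i₀ (Sum.inl t)) Finset.univ_nonempty
    rw [Finset.card_eq_one]
    refine ⟨insert (Sum.inl t) Z₀, ?_⟩
    ext Y
    rw [hins Z₀ hZ₀D, Finset.mem_singleton]
    constructor
    · rintro ⟨w, ⟨hw, hd⟩, rfl⟩
      have hmax : ∀ t', r i₀ (Sum.inl t') ≤ r i₀ w := by
        intro t'
        obtain ⟨c, hc⟩ := hd (Sum.inl t')
        by_cases h : c = i₀
        · subst h; exact hc w (Finset.mem_insert_self _ _)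
        · exact absurd (hlow c (Sum.inl t') (by simp)) (not_lt.2
            (hc _ (Finset.mem_insert_of_mem ((hmem₀ _).2 ⟨c, h, rfl⟩))))
      congr 1
      rcases w with t' | c
      · exact hr i₀ (le_antisymm (ht t' (Finset.mem_univ _)) (hmax t))
      · exfalso
        by_cases h : c = i₀
        · subst h
          exact absurd (hlow c (Sum.inl t) (by simp)) (not_lt.2 (hmax t))
        · exact hw ((hmem₀ _).2 ⟨c, h, rfl⟩)
    · rintro rfl
      refine ⟨_, ⟨by simp [hmem₀], ?_⟩, rfl⟩
      rintro (t' | c)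
      · refine ⟨i₀, fun y hy => ?_⟩
        rcases Finset.mem_insert.1 hy with rfl | hy
        · exact ht t' (Finset.mem_univ _)
        · obtain ⟨c, hc, rfl⟩ := (hmem₀ _).1 hy
          exact (hhigh _ _ _ hc).le
      · refine ⟨c, fun y _ => ?_⟩
        by_cases h : y = Sum.inr c
        · rw [h]
        · exact (hlow c y h).le
  have hright : ∀ Z ∈ D.erase Z₀, Even (R.bipartiteBelow (fun Y Z => Z ⊆ Y) Z).card := by
    intro Z hZ
    obtain ⟨hne, hZD⟩ := Finset.mem_erase.1 hZ
    obtain ⟨hZc, hZd, hZl⟩ := (hD Z).1 hZD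
    -- a set of slack elements only would have to be `Z₀`
    obtain ⟨t, ht⟩ : ∃ t, Sum.inl t ∈ Z := by
      by_contra hno
      push Not at hno
      refine hne (Finset.eq_of_subset_of_card_le (fun w hw => ?_) ?_).symm
      · obtain ⟨c, hc, rfl⟩ := (hmem₀ _).1 hw
        obtain ⟨z, hz, hzc⟩ := hZl c hc
        rcases z with t | c'
        · exact absurd hz (hno t)
        · simp only [hl, Sum.elim_inr, id] at hzc
          rwa [← hzc]
      · have := ((hD _).1 hZ₀D).1
        omega
    obtain ⟨w₁, w₂, hw, hiff⟩ := hZd.exists_pair_insert hr hZc ⟨_, ht⟩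
      (fun k => ⟨Sum.inr k, fun c hc => ⟨_, ht, hhigh c k t hc.symm⟩⟩)
    have hset : R.bipartiteBelow (fun Y Z => Z ⊆ Y) Z = {insert w₁ Z, insert w₂ Z} := by
      ext Y
      rw [hins Z hZD]
      simp only [hiff, Finset.mem_insert, Finset.mem_singleton]
      constructor
      · rintro ⟨w, rfl | rfl, rfl⟩
        · exact Or.inl rfl
        · exact Or.inr rfl
      · rintro (rfl | rfl)
        · exact ⟨w₁, Or.inl rfl, rfl⟩
        · exact ⟨w₂, Or.inr rfl, rfl⟩
    rw [hset, Finset.card_pair]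
    · exact even_two
    · intro h
      have h1 : w₁ ∈ insert w₂ Z := h ▸ Finset.mem_insert_self w₁ Z
      rcases Finset.mem_insert.1 h1 with h1 | h1
      · exact hw h1
      · exact ((hiff w₁).2 (Or.inl rfl)).1 h1
  rw [hcount, ← Finset.add_sum_erase _ _ hZ₀D, hright₀] at hleft
  have := Finset.even_sum _ hright
  rw [Nat.even_add, iff_true_right this] at hleft
  exact Nat.not_even_one hleft

/-! ### The Knaster–Kuratowski–Mazurkiewicz theorem -/

/-- A discrete form of the Knaster–Kuratowski–Mazurkiewicz theorem: for each labelling of the grid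
points of the simplex of size `L`, there is a small cell with lower corner `a` in which each label
`i` occurs unless the cell touches the facet on which the `i`-th coordinate vanishes. -/
theorem exists_grid_cell {ι : Type*} [Fintype ι] [Nonempty ι] (L : ℕ) (lab : (ι → ℕ) → ι) :
    ∃ a : ι → ℕ, ∑ i, a i ≤ L ∧ L < ∑ i, a i + Fintype.card ι ∧
      ∀ i, a i = 0 ∨ ∃ x : ι → ℕ, ∑ j, x j = L ∧ lab x = i ∧
        ∀ j, a j ≤ x j ∧ x j < a j + Fintype.card ι := by
  classical
  let T := {x : ι → ℕ // x ∈ Finset.piAntidiag Finset.univ L}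
  let _ : Fintype T := Finset.fintypeCoeSort _
  have hT : ∀ x : ι → ℕ, x ∈ Finset.piAntidiag Finset.univ L ↔ ∑ j, x j = L := fun x => by simp
  obtain ⟨i₀⟩ := ‹Nonempty ι›
  have : Nonempty T := ⟨⟨Pi.single i₀ L, (hT _).2 (by simp)⟩⟩
  have : Nonempty ι := ⟨i₀⟩
  let K := Fintype.card (T ⊕ ι)
  let e : T ⊕ ι ≃ Fin K := Fintype.equivFin _
  -- the height of a grid point in the `i`-th ranking is its `i`-th coordinate; `e` breaks ties
  let h : ι → T ⊕ ι → ℕ := fun i =>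
    Sum.elim (fun t => t.1 i + 1) (fun j => if j = i then 0 else L + 2)
  let r : ι → T ⊕ ι → ℕ := fun i w => K * h i w + e w
  have hlt : ∀ i w w', h i w < h i w' → r i w < r i w' := by
    intro i w w' hw
    have h1 : K * (h i w + 1) ≤ K * h i w' := Nat.mul_le_mul_left _ hw
    have h2 : (e w : ℕ) < K := (e w).2
    simp only [r]
    rw [mul_add] at h1
    omega
  have hinj : ∀ i, Function.Injective (r i) := by
    intro i w w' hww
    have h1 : h i w = h i w' :=
      le_antisymm (not_lt.1 fun H => (hlt i _ _ H).ne' hww) (not_lt.1 fun H => (hlt i _ _ H).ne hww)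
    simp only [r, h1] at hww
    exact e.injective (Fin.ext (by omega))
  have hle : ∀ (t : T) i, t.1 i ≤ L := by
    intro t i
    exact (Finset.single_le_sum (f := t.1) (fun _ _ => Nat.zero_le _) (Finset.mem_univ i)).trans
      ((hT _).1 t.2).le
  have hlow : ∀ i w, w ≠ Sum.inr i → r i (Sum.inr i) < r i w := by
    rintro i (t | j) hw
    · exact hlt _ _ _ (by simp [h])
    · have : j ≠ i := fun H => hw (by rw [H])
      exact hlt _ _ _ (by simp [h, this])
  have hhigh : ∀ i j t, j ≠ i → r i (Sum.inl t) < r i (Sum.inr j) := by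
    intro i j t hji
    have := hle t i
    exact hlt _ _ _ (by simp only [h, Sum.elim_inl, Sum.elim_inr, if_neg hji]; omega)
  obtain ⟨Y, hYd, hYl⟩ := exists_isDominant_forall_label hinj hlow hhigh fun t : T => lab t.1
  have hlab : ∀ i, Sum.inr i ∉ Y → ∃ x : T, Sum.inl x ∈ Y ∧ lab x.1 = i := by
    intro i hi
    obtain ⟨y | j, hy, hyi⟩ := hYl i
    · exact ⟨y, hy, hyi⟩
    · simp only [Sum.elim_inr, id] at hyi
      exact absurd (hyi ▸ hy) hi
  have hdom : ∀ t : T, ∃ i, Sum.inr i ∉ Y ∧ ∀ x : T, Sum.inl x ∈ Y → t.1 i ≤ x.1 i := by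
    intro t
    obtain ⟨i, hi⟩ := hYd (Sum.inl t)
    refine ⟨i, fun H => absurd (hlow i (Sum.inl t) (by simp)) (not_lt.2 (hi _ H)), fun x hx => ?_⟩
    by_contra hcon
    exact absurd (hlt i (Sum.inl x) (Sum.inl t) (by simp only [h, Sum.elim_inl]; omega))
      (not_lt.2 (hi _ hx))
  have hmin : ∀ i, ∃ a : ℕ, (∀ x : T, Sum.inl x ∈ Y → a ≤ x.1 i) ∧
      (Sum.inr i ∈ Y → a = 0) ∧ (Sum.inr i ∉ Y → ∃ x : T, Sum.inl x ∈ Y ∧ x.1 i = a) := by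
    intro i
    by_cases hi : Sum.inr i ∈ Y
    · exact ⟨0, fun _ _ => Nat.zero_le _, fun _ => rfl, fun H => absurd hi H⟩
    · obtain ⟨x₀, hx₀, -⟩ := hlab i hi
      obtain ⟨x, hx, hxmin⟩ := Finset.exists_min_image
        (Finset.univ.filter fun x : T => Sum.inl x ∈ Y) (fun x => x.1 i) ⟨x₀, by simpa using hx₀⟩
      simp only [Finset.mem_filter, Finset.mem_univ, true_and] at hx hxmin
      exact ⟨x.1 i, hxmin, fun H => absurd H hi, fun _ => ⟨x, hx, rfl⟩⟩
  choose a ha ha0 hax using hmin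
  have hsum : ∀ x : T, Sum.inl x ∈ Y → ∑ i, a i ≤ L := fun x hx => by
    rw [← (hT _).1 x.2]
    exact Finset.sum_le_sum fun i _ => ha i x hx
  have hbig : L < ∑ i, a i + Fintype.card ι := by
    by_contra hcon
    -- otherwise there is a grid point all of whose coordinates exceed those of `a`
    have hs : ∑ i, (a i + 1) = ∑ i, a i + Fintype.card ι := by
      rw [Finset.sum_add_distrib, Finset.sum_const, Finset.card_univ, smul_eq_mul, mul_one]
    let t : ι → ℕ := fun i => a i + 1 + (Pi.single i₀ (L - ∑ i, (a i + 1)) : ι → ℕ) i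
    have ht : ∑ i, t i = L := by
      simp only [t]
      rw [Finset.sum_add_distrib, Finset.sum_pi_single' , if_pos (Finset.mem_univ _)]
      omega
    obtain ⟨i, hi, hit⟩ := hdom ⟨t, (hT _).2 ht⟩
    obtain ⟨x, hx, hxa⟩ := hax i hi
    have := hit x hx
    simp only [t] at this
    omega
  obtain ⟨i₁, hi₁, -⟩ := hdom (Classical.arbitrary T)
  obtain ⟨x₁, hx₁, -⟩ := hlab i₁ hi₁
  refine ⟨a, hsum x₁ hx₁, hbig, fun i => ?_⟩
  by_cases hi : Sum.inr i ∈ Y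
  · exact Or.inl (ha0 i hi)
  · obtain ⟨x, hx, hxi⟩ := hlab i hi
    have hxs := (hT _).1 x.2
    refine Or.inr ⟨x.1, hxs, hxi, fun j => ⟨ha j x hx, ?_⟩⟩
    have h1 : ∑ j, a j + ∑ j, (x.1 j - a j) = L := by
      rw [← Finset.sum_add_distrib]
      refine Eq.trans ?_ hxs
      exact Finset.sum_congr rfl fun j _ => Nat.add_sub_of_le (ha j x hx)
    have h2 : x.1 j - a j ≤ ∑ j, (x.1 j - a j) :=
      Finset.single_le_sum (f := fun j => x.1 j - a j) (fun _ _ => Nat.zero_le _)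
        (Finset.mem_univ j)
    omega

/-- The Knaster–Kuratowski–Mazurkiewicz theorem, for closed sets containing the facets of the
simplex: if they cover the simplex, they have a common point in it. -/
theorem exists_mem_stdSimplex_forall_mem {ι : Type*} [Fintype ι] [Nonempty ι]
    {D : ι → Set (ι → ℝ)} (hclosed : ∀ i, IsClosed (D i))
    (hcover : ∀ s ∈ stdSimplex ℝ ι, ∃ i, s ∈ D i)
    (hfacet : ∀ s ∈ stdSimplex ℝ ι, ∀ i, s i = 0 → s ∈ D i) :
    ∃ s ∈ stdSimplex ℝ ι, ∀ i, s ∈ D i := by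
  classical
  set N := Fintype.card ι with hN
  have hlab : ∀ L : ℕ, ∃ lab : (ι → ℕ) → ι, ∀ x : ι → ℕ, ∑ j, x j = L + 1 →
      (fun j => (x j : ℝ) / ((L : ℝ) + 1)) ∈ D (lab x) := by
    intro L
    have : ∀ x : ι → ℕ, ∃ i, ∑ j, x j = L + 1 → (fun j => (x j : ℝ) / ((L : ℝ) + 1)) ∈ D i := by
      intro x
      by_cases hx : ∑ j, x j = L + 1
      · obtain ⟨i, hi⟩ := hcover (fun j => (x j : ℝ) / ((L : ℝ) + 1)) ⟨fun j => by positivity, by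
          rw [← Finset.sum_div, ← Nat.cast_sum, hx, Nat.cast_succ]
          exact div_self (by positivity)⟩
        exact ⟨i, fun _ => hi⟩
      · exact ⟨Classical.arbitrary ι, fun H => absurd H hx⟩
    choose lab h using this
    exact ⟨lab, h⟩
  choose lab hlab using hlab
  choose a hle hgt hcell using fun L : ℕ => exists_grid_cell (L + 1) (lab L)
  let p : ℕ → ι → ℝ := fun L i => (a L i : ℝ) / ((L : ℝ) + 1)
  have hpos : ∀ L : ℕ, (0 : ℝ) < (L : ℝ) + 1 := fun L => by positivity
  have hpsum : ∀ L, ∑ i, p L i = ((∑ i, a L i : ℕ) : ℝ) / ((L : ℝ) + 1) := fun L => by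
    simp only [p]
    rw [← Finset.sum_div, Nat.cast_sum]
  have hpsum_le : ∀ L, ∑ i, p L i ≤ 1 := fun L => by
    rw [hpsum, div_le_one (hpos L)]
    exact_mod_cast hle L
  have hpnn : ∀ L i, 0 ≤ p L i := fun L i => by positivity
  have hp : ∀ L, p L ∈ Set.Icc (0 : ι → ℝ) 1 := fun L =>
    ⟨fun i => hpnn L i, fun i =>
      (Finset.single_le_sum (fun j _ => hpnn L j) (Finset.mem_univ i)).trans (hpsum_le L)⟩
  obtain ⟨s, -, φ, hφ, hlim⟩ := isCompact_Icc.tendsto_subseq hp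
  have hlim_i : ∀ i, Filter.Tendsto (fun L => p (φ L) i) Filter.atTop (nhds (s i)) := fun i =>
    (tendsto_pi_nhds.1 hlim) i
  have hsmall : Filter.Tendsto (fun L => (N : ℝ) / ((φ L : ℝ) + 1)) Filter.atTop (nhds 0) :=
    (((tendsto_const_div_atTop_nhds_zero_nat (N : ℝ)).comp (Filter.tendsto_add_atTop_nat 1)).comp
      hφ.tendsto_atTop).congr fun L => by simp
  have hs1 : ∑ i, s i = 1 := by
    have h1 : Filter.Tendsto (fun L => ∑ i, p (φ L) i) Filter.atTop (nhds (∑ i, s i)) :=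
      tendsto_finsetSum _ fun i _ => hlim_i i
    refine tendsto_nhds_unique h1 ?_
    have h2 : Filter.Tendsto (fun L => 1 - (N : ℝ) / ((φ L : ℝ) + 1)) Filter.atTop (nhds 1) := by
      simpa using hsmall.const_sub 1
    refine tendsto_of_tendsto_of_tendsto_of_le_of_le h2 tendsto_const_nhds (fun L => ?_)
      (fun L => hpsum_le _)
    change 1 - (N : ℝ) / ((φ L : ℝ) + 1) ≤ ∑ i, p (φ L) i
    rw [hpsum, sub_le_iff_le_add, ← add_div, one_le_div (hpos _)]
    exact_mod_cast (hgt (φ L)).le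
  have hs : s ∈ stdSimplex ℝ ι :=
    ⟨fun i => ge_of_tendsto' (hlim_i i) fun L => hpnn _ _, hs1⟩
  refine ⟨s, hs, fun i => ?_⟩
  by_contra hi
  have hsi : 0 < s i := lt_of_le_of_ne (hs.1 i) fun H => hi (hfacet s hs i H.symm)
  obtain ⟨ε, hε, hball⟩ := Metric.isOpen_iff.1 (hclosed i).isOpen_compl s hi
  have e1 := (Metric.tendsto_nhds.1 hlim) (ε / 2) (half_pos hε)
  have e2 := (hlim_i i).eventually_const_lt hsi
  have e3 := hsmall.eventually_lt_const (half_pos hε)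
  obtain ⟨L, h1, h2, h3⟩ := (e1.and (e2.and e3)).exists
  rcases hcell (φ L) i with h0 | ⟨x, hx, hxi, hxa⟩
  · simp [p, h0] at h2
  · refine @hball (fun j => (x j : ℝ) / ((φ L : ℝ) + 1)) ?_ (hxi ▸ hlab (φ L) x hx)
    rw [Metric.mem_ball]
    have h4 : dist (fun j => (x j : ℝ) / ((φ L : ℝ) + 1)) (p (φ L)) ≤
        (N : ℝ) / ((φ L : ℝ) + 1) := by
      refine (dist_pi_le_iff (by positivity)).2 fun j => ?_
      have h5 : (a (φ L) j : ℝ) ≤ x j := by exact_mod_cast (hxa j).1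
      have h6 : (x j : ℝ) ≤ a (φ L) j + N := by exact_mod_cast (hxa j).2.le
      rw [Real.dist_eq, ← sub_div, abs_of_nonneg (div_nonneg (by linarith) (hpos _).le)]
      exact div_le_div_of_nonneg_right (by linarith) (hpos _).le
    have h7 := dist_triangle (fun j => (x j : ℝ) / ((φ L : ℝ) + 1)) (p (φ L)) s
    have h8 : dist (p (φ L)) s < ε / 2 := h1
    linarith

/-! ### CAT(0) geometry -/

/-- A set is geodesically convex if it contains every point of every geodesic between two of its
points; in a geodesic space these are the points `m` with `dist p m + dist m q = dist p q`. -/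
def IsGeodConvex {X : Type*} [MetricSpace X] (A : Set X) : Prop :=
  ∀ p ∈ A, ∀ q ∈ A, ∀ m, dist p m + dist m q = dist p q → m ∈ A

theorem IsGeodConvex.iInter {X κ : Type*} [MetricSpace X] {A : κ → Set X}
    (hA : ∀ i, IsGeodConvex (A i)) : IsGeodConvex (⋂ i, A i) := by
  intro p hp q hq m hm
  rw [Set.mem_iInter] at *
  exact fun i => hA i p (hp i) q (hq i) m hm

/-- Any three points of a metric space have a comparison triangle in the Euclidean plane. -/
theorem exists_comparison_triangle {X : Type*} [MetricSpace X] (x y z : X) :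
    ∃ x' y' z' : EuclideanSpace ℝ (Fin 2),
      dist x' y' = dist x y ∧ dist y' z' = dist y z ∧ dist x' z' = dist x z := by
  set a := dist x y
  set b := dist y z
  set c := dist x z
  have ha : 0 ≤ a := dist_nonneg
  have hb : 0 ≤ b := dist_nonneg
  have hc : 0 ≤ c := dist_nonneg
  have h1 : a ≤ c + b := by
    have := dist_triangle x z y
    rwa [dist_comm z y] at this
  have h2 : b ≤ a + c := by
    have := dist_triangle y x z
    rwa [dist_comm y x] at this
  have h3 : c ≤ a + b := dist_triangle x y z
  rcases ha.eq_or_lt with h0 | h0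
  · refine ⟨!₂[0, 0], !₂[0, 0], !₂[c, 0], ?_, ?_, ?_⟩
    · simpa using h0
    · rw [EuclideanSpace.dist_eq, Fin.sum_univ_two]
      simp [Real.dist_eq, Real.sqrt_sq hc]
      linarith
    · rw [EuclideanSpace.dist_eq, Fin.sum_univ_two]
      simp [Real.dist_eq, Real.sqrt_sq hc]
  · set u := (a ^ 2 + c ^ 2 - b ^ 2) / (2 * a) with hu
    have hau : 2 * a * u = a ^ 2 + c ^ 2 - b ^ 2 := by rw [hu]; field_simp
    have huc : u ^ 2 ≤ c ^ 2 := by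
      have e1 : 2 * a * (c - u) = (b - a + c) * (b + a - c) := by linear_combination -hau
      have e2 : 2 * a * (c + u) = (a + c - b) * (a + c + b) := by linear_combination hau
      have e3 : 0 ≤ 2 * a * (c - u) := by
        rw [e1]; exact mul_nonneg (by linarith) (by linarith)
      have e4 : 0 ≤ 2 * a * (c + u) := by
        rw [e2]; exact mul_nonneg (by linarith) (by linarith)
      have e5 := nonneg_of_mul_nonneg_right e3 (by linarith)
      have e6 := nonneg_of_mul_nonneg_right e4 (by linarith)
      nlinarith
    set v := Real.sqrt (c ^ 2 - u ^ 2) with hv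
    have hv2 : v ^ 2 = c ^ 2 - u ^ 2 := Real.sq_sqrt (by linarith)
    refine ⟨!₂[0, 0], !₂[a, 0], !₂[u, v], ?_, ?_, ?_⟩ <;>
      rw [EuclideanSpace.dist_eq, Fin.sum_univ_two, Real.sqrt_eq_iff_mul_self_eq (by positivity)
        (by assumption)] <;>
      simp only [Real.dist_eq, sq_abs, Matrix.cons_val_zero, Matrix.cons_val_one] <;>
      linarith

section

variable {X : Type*} [MetricSpace X] [IsCAT0 X]

/-- Points dividing two sides of a triangle in the same ratio: the homothety towards the common
vertex `x` is contracting. -/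
theorem IsCAT0.dist_le_mul_dist {x y z p q : X} {t : ℝ} (ht0 : 0 ≤ t) (ht1 : t ≤ 1)
    (h1 : dist x p = t * dist x y) (h2 : dist p y = (1 - t) * dist x y)
    (h3 : dist x q = t * dist x z) (h4 : dist q z = (1 - t) * dist x z) :
    dist p q ≤ t * dist y z := by
  obtain ⟨x', y', z', hxy, hyz, hxz⟩ := exists_comparison_triangle x y z
  have e1 : ‖t‖ = t := Real.norm_of_nonneg ht0
  have e2 : ‖1 - t‖ = 1 - t := Real.norm_of_nonneg (by linarith)
  have h := IsCAT0.dist_le_comparison x y z p q x' y' z' (AffineMap.lineMap x' y' t)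
    (AffineMap.lineMap x' z' t) hxy hyz hxz (by rw [h1, h2]; ring) (by rw [h3, h4]; ring)
    (by rw [dist_left_lineMap, e1, hxy, h1]) (by rw [dist_lineMap_right, e2, hxy, h2])
    (by rw [dist_left_lineMap, e1, hxz, h3]) (by rw [dist_lineMap_right, e2, hxz, h4])
  refine h.trans (le_of_eq ?_)
  rw [← hyz, dist_eq_norm, dist_eq_norm, AffineMap.lineMap_apply_module',
    AffineMap.lineMap_apply_module', add_sub_add_right_eq_sub, ← smul_sub, norm_smul, e1,
    sub_sub_sub_cancel_right]

theorem IsCAT0.dist_le_abs_sub_mul_dist {x y p q : X} {s t : ℝ} (hs0 : 0 ≤ s) (hs1 : s ≤ 1)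
    (ht0 : 0 ≤ t) (ht1 : t ≤ 1)
    (h1 : dist x p = s * dist x y) (h2 : dist p y = (1 - s) * dist x y)
    (h3 : dist x q = t * dist x y) (h4 : dist q y = (1 - t) * dist x y) :
    dist p q ≤ |s - t| * dist x y := by
  obtain ⟨x', y', -, hxy, -, -⟩ := exists_comparison_triangle x y y
  have e1 : ‖s‖ = s := Real.norm_of_nonneg hs0
  have e2 : ‖1 - s‖ = 1 - s := Real.norm_of_nonneg (by linarith)
  have e3 : ‖t‖ = t := Real.norm_of_nonneg ht0
  have e4 : ‖1 - t‖ = 1 - t := Real.norm_of_nonneg (by linarith)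
  have h := IsCAT0.dist_le_comparison x y y p q x' y' y' (AffineMap.lineMap x' y' s)
    (AffineMap.lineMap x' y' t) hxy (by simp) hxy (by rw [h1, h2]; ring) (by rw [h3, h4]; ring)
    (by rw [dist_left_lineMap, e1, hxy, h1]) (by rw [dist_lineMap_right, e2, hxy, h2])
    (by rw [dist_left_lineMap, e3, hxy, h3]) (by rw [dist_lineMap_right, e4, hxy, h4])
  rwa [dist_lineMap_lineMap, hxy, Real.dist_eq] at h

/-- The inequality of Bruhat and Tits for a midpoint `m` of `x` and `y`. -/
theorem IsCAT0.dist_sq_midpoint_le {x y m : X} (h1 : dist x m = dist x y / 2)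
    (h2 : dist m y = dist x y / 2) (z : X) :
    dist z m ^ 2 ≤ (dist z x ^ 2 + dist z y ^ 2) / 2 - dist x y ^ 2 / 4 := by
  obtain ⟨x', y', z', hxy, hyz, hxz⟩ := exists_comparison_triangle x y z
  have h := IsCAT0.dist_le_comparison x y z m z x' y' z' (midpoint ℝ x' y') z' hxy hyz hxz
    (by rw [h1, h2]; ring) (by simp)
    (by rw [dist_left_midpoint, hxy, h1]; simp; ring)
    (by rw [dist_midpoint_right, hxy, h2]; simp; ring) hxz (by simp)
  have h5 := EuclideanGeometry.dist_sq_add_dist_sq_eq_two_mul_dist_midpoint_sq_add_half_dist_sq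
    z' x' y'
  rw [dist_comm z' x', dist_comm z' y', hxz, hyz, hxy] at h5
  rw [dist_comm m z, dist_comm _ z'] at h
  have h6 : dist z m ^ 2 ≤ dist z' (midpoint ℝ x' y') ^ 2 := by gcongr
  rw [dist_comm z x, dist_comm z y]
  nlinarith

/-- Geodesics are unique: a point is determined by its distances to the end points. -/
theorem IsCAT0.eq_of_dist_eq {x y p q : X} (hp : dist x p + dist p y = dist x y)
    (h1 : dist x q = dist x p) (h2 : dist q y = dist p y) : q = p := by
  rcases (dist_nonneg (x := x) (y := y)).eq_or_lt with h0 | h0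
  · have e1 := dist_nonneg (x := x) (y := p)
    have e2 := dist_nonneg (x := p) (y := y)
    have e3 : dist x p = 0 := by linarith
    rw [← dist_eq_zero.1 e3] at h1 ⊢
    rw [dist_self] at h1
    exact (dist_eq_zero.1 h1).symm
  · have ht0 : 0 ≤ dist x p / dist x y := by positivity
    have ht1 : dist x p / dist x y ≤ 1 :=
      (div_le_one h0).2 (by linarith [dist_nonneg (x := p) (y := y)])
    have e1 : dist x p = dist x p / dist x y * dist x y := by field_simp
    have e2 : dist p y = (1 - dist x p / dist x y) * dist x y := by
      rw [sub_mul, ← e1]; linarith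
    have h := IsCAT0.dist_le_abs_sub_mul_dist ht0 ht1 ht0 ht1 (h1.trans e1) (h2.trans e2) e1 e2
    rw [sub_self, abs_zero, zero_mul] at h
    exact dist_le_zero.1 h

theorem IsometryEquiv.isGeodConvex_fixedPoints (s : X ≃ᵢ X) : IsGeodConvex {x | s x = x} := by
  intro p hp q hq m hm
  rw [Set.mem_ofPred_eq] at *
  refine IsCAT0.eq_of_dist_eq hm ?_ ?_
  · conv_lhs => rw [← hp, s.dist_eq]
  · conv_lhs => rw [← hq, s.dist_eq]

theorem IsometryEquiv.isClosed_fixedPoints {X : Type*} [MetricSpace X] (s : X ≃ᵢ X) :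
    IsClosed {x | s x = x} :=
  isClosed_eq s.continuous continuous_id

theorem IsCAT0.exists_point (x y : X) {t : ℝ} (ht0 : 0 ≤ t) (ht1 : t ≤ 1) :
    ∃ m, dist x m = t * dist x y ∧ dist m y = (1 - t) * dist x y := by
  obtain ⟨γ, h0, h1, hγ⟩ := IsCAT0.exists_geodesic x y
  have hd : 0 ≤ dist x y := dist_nonneg
  have hm : t * dist x y ∈ Set.Icc 0 (dist x y) :=
    ⟨by positivity, mul_le_of_le_one_left hd ht1⟩
  refine ⟨γ (t * dist x y), ?_, ?_⟩
  · have h := hγ 0 ⟨le_rfl, hd⟩ _ hm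
    rwa [h0, zero_sub, abs_neg, abs_of_nonneg hm.1] at h
  · have h := hγ _ hm _ ⟨hd, le_rfl⟩
    rw [h1, abs_sub_comm, abs_of_nonneg (by linarith [hm.2])] at h
    rw [h]
    ring

/-- Two points of a geodesically convex set that are almost nearest to `z` are close to each
other. -/
theorem IsGeodConvex.dist_sq_le {A : Set X} (hA : IsGeodConvex A) {z p q : X} (hp : p ∈ A)
    (hq : q ∈ A) {d ε : ℝ} (hd0 : 0 ≤ d) (hd : ∀ x ∈ A, d ≤ dist z x) (hzp : dist z p ≤ d + ε)
    (hzq : dist z q ≤ d + ε) : dist p q ^ 2 ≤ 4 * (2 * d * ε + ε ^ 2) := by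
  obtain ⟨m, h1, h2⟩ := IsCAT0.exists_point p q (t := 1 / 2) (by norm_num) (by norm_num)
  have h := IsCAT0.dist_sq_midpoint_le (x := p) (y := q) (m := m) (by linarith) (by linarith) z
  have hm := hd m (hA p hp q hq m (by linarith))
  have e1 : d ^ 2 ≤ dist z m ^ 2 := by gcongr
  have e2 : dist z p ^ 2 ≤ (d + ε) ^ 2 := by gcongr
  have e3 : dist z q ^ 2 ≤ (d + ε) ^ 2 := by gcongr
  nlinarith

/-- Existence of the nearest point of a closed convex set in a complete CAT(0) space. -/
theorem IsGeodConvex.exists_nearest [CompleteSpace X] {A : Set X} (hA : IsGeodConvex A)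
    (hc : IsClosed A) (hne : A.Nonempty) (z : X) : ∃ p ∈ A, ∀ x ∈ A, dist z p ≤ dist z x := by
  set d := Metric.infDist z A with hd
  have hd0 : 0 ≤ d := Metric.infDist_nonneg
  have hdle : ∀ x ∈ A, d ≤ dist z x := fun x hx => Metric.infDist_le_dist_of_mem hx
  have hex : ∀ n : ℕ, ∃ p ∈ A, dist z p < d + 1 / ((n : ℝ) + 1) := fun n =>
    (Metric.infDist_lt_iff hne).1 (lt_add_of_pos_right _ (by positivity))
  choose p hpA hp using hex
  have hε : Filter.Tendsto (fun n : ℕ => 1 / ((n : ℝ) + 1)) Filter.atTop (nhds 0) :=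
    tendsto_one_div_add_atTop_nhds_zero_nat
  have hcau : CauchySeq p := by
    refine cauchySeq_of_le_tendsto_0
      (fun n : ℕ => Real.sqrt (4 * (2 * d * (1 / ((n : ℝ) + 1)) + (1 / ((n : ℝ) + 1)) ^ 2))) ?_ ?_
    · intro n m N hn hm
      refine Real.le_sqrt_of_sq_le (hA.dist_sq_le (hpA n) (hpA m) hd0 hdle ?_ ?_)
      · exact (hp n).le.trans (by gcongr)
      · exact (hp m).le.trans (by gcongr)
    · have := (((hε.const_mul (2 * d)).add (hε.pow 2)).const_mul 4).sqrt
      simpa using this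
  obtain ⟨q, hq⟩ := cauchySeq_tendsto_of_complete hcau
  have hqA : q ∈ A := hc.mem_of_tendsto hq (Filter.Eventually.of_forall hpA)
  refine ⟨q, hqA, fun x hx => le_trans ?_ (hdle x hx)⟩
  have h1 : Filter.Tendsto (fun n => dist z (p n)) Filter.atTop (nhds (dist z q)) :=
    tendsto_const_nhds.dist hq
  have h2 : Filter.Tendsto (fun n : ℕ => d + 1 / ((n : ℝ) + 1)) Filter.atTop (nhds d) := by
    simpa using hε.const_add d
  exact le_of_tendsto_of_tendsto' h1 h2 fun n => (hp n).le

/-- If finitely many families of isometries commute with one another and each has a common fixed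
point, then there is a point fixed by all of them: the nearest point projection onto the fixed set
of some of the families preserves the fixed set of any other family. -/
theorem exists_common_fixedPoint [CompleteSpace X] [Nonempty X] {κ : Type*} [Finite κ]
    {Q : κ → Set (X ≃ᵢ X)} (hcomm : ∀ i j, i ≠ j → ∀ s ∈ Q i, ∀ t ∈ Q j, Commute s t)
    (hfix : ∀ i, ∃ x : X, ∀ s ∈ Q i, s x = x) : ∃ x : X, ∀ i, ∀ s ∈ Q i, s x = x := by
  classical
  have := Fintype.ofFinite κ
  suffices h : ∀ F : Finset κ, ∃ x : X, ∀ i ∈ F, ∀ s ∈ Q i, s x = x by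
    obtain ⟨x, hx⟩ := h Finset.univ
    exact ⟨x, fun i => hx i (Finset.mem_univ i)⟩
  intro F
  induction F using Finset.induction with
  | empty => exact ⟨Classical.arbitrary X, by simp⟩
  | insert j F hj ih =>
    let A : Set X := {x | ∀ i ∈ F, ∀ s ∈ Q i, s x = x}
    have hAeq : A = ⋂ i : {p : κ × (X ≃ᵢ X) // p.1 ∈ F ∧ p.2 ∈ Q p.1}, {x | i.1.2 x = x} := by
      ext x
      simp only [A, Set.mem_ofPred_eq, Set.mem_iInter]
      exact ⟨fun h i => h _ i.2.1 _ i.2.2, fun h i hi s hs => h ⟨(i, s), hi, hs⟩⟩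
    have hconv : IsGeodConvex A := by
      rw [hAeq]; exact IsGeodConvex.iInter fun i => IsometryEquiv.isGeodConvex_fixedPoints _
    have hclosed : IsClosed A := by
      rw [hAeq]; exact isClosed_iInter fun i => IsometryEquiv.isClosed_fixedPoints _
    obtain ⟨z, hz⟩ := hfix j
    obtain ⟨p, hpA, hp⟩ := hconv.exists_nearest hclosed ih z
    refine ⟨p, fun i hi s hs => ?_⟩
    rcases Finset.mem_insert.1 hi with rfl | hi
    · have hspA : s p ∈ A := by
        intro i' hi' t ht
        have hne : i' ≠ i := fun H => hj (H ▸ hi')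
        have h1 : (t * s) p = (s * t) p := by rw [(hcomm i' i hne t ht s hs).eq]
        rw [IsometryEquiv.mul_apply, IsometryEquiv.mul_apply, hpA i' hi' t ht] at h1
        exact h1
      have hd : dist z (s p) = dist z p := by
        conv_lhs => rw [← hz s hs, s.dist_eq]
      have h := hconv.dist_sq_le (z := z) hspA hpA (d := dist z p) (ε := 0) dist_nonneg hp
        (by linarith) (by linarith)
      have h0 : dist (s p) p ^ 2 ≤ 0 := by linarith
      exact dist_eq_zero.1 (pow_eq_zero_iff two_ne_zero |>.1 (le_antisymm h0 (sq_nonneg _)))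
    · exact hpA i hi s hs

/-- A substitute for simplices with given vertices. Given vertices `x j` and weights
`c j : Z → [0, 1]` there is a continuous map `f` on `Z` such that `f z` lies in each geodesically
convex set that contains all `x j` of non-zero weight, provided that some weight equals `1` at `z`.
The map starts at an arbitrary point and moves, for one `j` after the other, the fraction `c j z`
of the way towards `x j`; where this fraction is `1` the starting point is forgotten. -/
theorem exists_continuous_mem_of_isGeodConvex [Nonempty X] {Z J : Type*} [TopologicalSpace Z]
    [Finite J] (x : J → X) {c : J → Z → ℝ} (hc : ∀ j, Continuous (c j))
    (hc01 : ∀ j z, c j z ∈ Set.Icc (0 : ℝ) 1) :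
    ∃ f : Z → X, Continuous f ∧ ∀ z, (∃ j, c j z = 1) → ∀ A : Set X, IsGeodConvex A →
      (∀ j, c j z ≠ 0 → x j ∈ A) → f z ∈ A := by
  classical
  have := Fintype.ofFinite J
  suffices h : ∀ F : Finset J, ∃ f : Z → X, Continuous f ∧ ∀ z, (∃ j ∈ F, c j z = 1) →
      ∀ A : Set X, IsGeodConvex A → (∀ j ∈ F, c j z ≠ 0 → x j ∈ A) → f z ∈ A by
    obtain ⟨f, hf, h⟩ := h Finset.univ
    exact ⟨f, hf, fun z ⟨j, hj⟩ A hA hx =>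
      h z ⟨j, Finset.mem_univ j, hj⟩ A hA fun j _ => hx j⟩
  intro F
  induction F using Finset.induction with
  | empty => exact ⟨fun _ => Classical.arbitrary X, continuous_const, by simp⟩
  | insert j F hj ih =>
    obtain ⟨f, hf, hfA⟩ := ih
    have hex : ∀ z, ∃ m, dist (f z) m = c j z * dist (f z) (x j) ∧
        dist m (x j) = (1 - c j z) * dist (f z) (x j) := fun z =>
      IsCAT0.exists_point _ _ (hc01 j z).1 (hc01 j z).2
    choose g hg1 hg2 using hex
    refine ⟨g, ?_, ?_⟩
    · refine continuous_iff_continuousAt.2 fun z₀ => ?_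
      have hbound : ∀ z, dist (g z) (g z₀) ≤
          dist (f z) (f z₀) + |c j z - c j z₀| * dist (f z₀) (x j) := by
        intro z
        obtain ⟨m, hm1, hm2⟩ :=
          IsCAT0.exists_point (f z₀) (x j) (hc01 j z).1 (hc01 j z).2
        have h1 : dist (g z) m ≤ (1 - c j z) * dist (f z) (f z₀) := by
          refine IsCAT0.dist_le_mul_dist (x := x j) (by linarith [(hc01 j z).2])
            (by linarith [(hc01 j z).1]) ?_ ?_ ?_ ?_
          · rw [dist_comm (x j), dist_comm (x j), hg2]
          · rw [dist_comm (g z), dist_comm (x j), hg1]; ring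
          · rw [dist_comm (x j), dist_comm (x j), hm2]
          · rw [dist_comm m, dist_comm (x j), hm1]; ring
        have h2 := IsCAT0.dist_le_abs_sub_mul_dist (hc01 j z).1 (hc01 j z).2 (hc01 j z₀).1
          (hc01 j z₀).2 hm1 hm2 (hg1 z₀) (hg2 z₀)
        have h3 : (1 - c j z) * dist (f z) (f z₀) ≤ dist (f z) (f z₀) :=
          mul_le_of_le_one_left dist_nonneg (by linarith [(hc01 j z).1])
        linarith [dist_triangle (g z) m (g z₀)]
      refine tendsto_iff_dist_tendsto_zero.2 (squeeze_zero (fun _ => dist_nonneg) hbound ?_)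
      have h1 : Continuous fun z => dist (f z) (f z₀) +
          |c j z - c j z₀| * dist (f z₀) (x j) := by
        have := hc j
        fun_prop
      have h2 := h1.tendsto z₀
      simpa using h2
    · rintro z ⟨i, hi, hi1⟩ A hA hx
      by_cases h1 : c j z = 1
      · have h2 := hg2 z
        rw [h1, sub_self, zero_mul] at h2
        rw [dist_eq_zero.1 h2]
        exact hx j (Finset.mem_insert_self _ _) (by rw [h1]; exact one_ne_zero)
      · have hiF : i ∈ F := by
          rcases Finset.mem_insert.1 hi with rfl | hi
          · exact absurd hi1 h1
          · exact hi
        have hfz : f z ∈ A := hfA z ⟨i, hiF, hi1⟩ A hA fun j' hj' =>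
          hx j' (Finset.mem_insert_of_mem hj')
        by_cases h0 : c j z = 0
        · have h2 := hg1 z
          rw [h0, zero_mul] at h2
          rwa [← dist_eq_zero.1 h2]
        · exact hA _ hfz _ (hx j (Finset.mem_insert_self _ _) h0) _
            (by rw [hg1, hg2]; ring)

end

/-! ### Maps from a simplex and the covering dimension -/

/-- A continuous map from a simplex to `X` that is incompatible with a small covering dimension:
the open sets `W i` cover `X`, and the facet opposite to the vertex `i` is mapped to the complement
of `W i`. A refinement of multiplicity at most `n` would have members inside different `W i`
without a common point, against the Knaster–Kuratowski–Mazurkiewicz theorem. -/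
theorem not_hasCoveringDimLT_of_continuous {X ι : Type*} [TopologicalSpace X] [Fintype ι]
    [Nonempty ι] {F : (ι → ℝ) → X} (hF : Continuous F) {W : ι → Set X} (hW : ∀ i, IsOpen (W i))
    (hcover : ⋃ i, W i = Set.univ) (hfacet : ∀ s ∈ stdSimplex ℝ ι, ∀ i, s i = 0 → F s ∉ W i)
    {n : ℕ} (hn : n < Fintype.card ι) : ¬ HasCoveringDimLT X n := by
  intro h
  obtain ⟨𝒱, hopen, huniv, href, hmult⟩ := h (Set.range W) (Set.finite_range W)
    (by rintro _ ⟨i, rfl⟩; exact hW i) (by rwa [Set.sUnion_range])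
  have hidx : ∀ V ∈ 𝒱, ∃ i, V ⊆ W i := by
    intro V hV
    obtain ⟨_, ⟨i, rfl⟩, hi⟩ := href V hV
    exact ⟨i, hi⟩
  choose! idx hidx using hidx
  let O : ι → Set X := fun i => ⋃ V ∈ {V ∈ 𝒱 | idx V = i}, V
  have hO : ∀ i x, x ∈ O i ↔ ∃ V ∈ 𝒱, idx V = i ∧ x ∈ V := fun i x => by
    simp only [O, Set.mem_iUnion, Set.mem_ofPred_eq, exists_prop, and_assoc]
  have hcov : ∀ s ∈ stdSimplex ℝ ι, ∃ i, s ∈ F ⁻¹' (O i)ᶜ := by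
    intro s _
    by_contra hcon
    push Not at hcon
    have hex : ∀ i, ∃ V ∈ 𝒱, idx V = i ∧ F s ∈ V := fun i =>
      (hO _ _).1 (not_not.1 (hcon i))
    choose V hV hVi hVs using hex
    have hinj : Function.Injective V := fun i j hij => by rw [← hVi i, ← hVi j, hij]
    have h1 : (Set.range V).encard ≤ n :=
      (Set.encard_le_encard (by rintro _ ⟨i, rfl⟩; exact ⟨hV i, hVs i⟩)).trans (hmult (F s))
    rw [← Set.image_univ, hinj.encard_image, Set.encard_univ, ENat.card_eq_coe_fintype_card] at h1
    exact absurd (Nat.cast_le.1 h1) (not_le.2 hn)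
  have hfac : ∀ s ∈ stdSimplex ℝ ι, ∀ i, s i = 0 → s ∈ F ⁻¹' (O i)ᶜ := by
    intro s hs i hsi hsO
    obtain ⟨V, hV, rfl, hsV⟩ := (hO _ _).1 hsO
    exact hfacet s hs _ hsi (hidx V hV hsV)
  obtain ⟨s, -, hs⟩ := exists_mem_stdSimplex_forall_mem (D := fun i => F ⁻¹' (O i)ᶜ)
    (fun i => (isOpen_biUnion fun V hV => hopen V hV.1).isClosed_compl.preimage hF) hcov hfac
  obtain ⟨V, hV, hsV⟩ := Set.mem_sUnion.1 (huniv ▸ Set.mem_univ (F s) : F s ∈ ⋃₀ 𝒱)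
  exact hs (idx V) ((hO _ _).2 ⟨V, hV, rfl, hsV⟩)

/-- Let the facet of a product of simplices on which the coordinate `o` of the `i`-th factor vanishes
be assigned the convex set `C i o`, and let each vertex `J` of the product be assigned a point `x J`
in the convex sets of the facets through `J`. Then there is a continuous map from one simplex of the
same dimension that respects the facets. The facet of the coordinate `none` is mapped to the union
of the sets `C i none`. It comes from a map of degree one of the simplex to the product of simplices,
under which the coordinate of `some ⟨i, b⟩` gives the coordinate `b` of the `i`-th factor. -/
theorem exists_continuous_simplex_of_product {X : Type*} [MetricSpace X] [IsCAT0 X] [Nonempty X]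
    {κ : Type*} [Fintype κ] {β : κ → Type*} [∀ i, Fintype (β i)]
    {C : ∀ i, Option (β i) → Set X} (hC : ∀ i o, IsGeodConvex (C i o))
    {x : (∀ i, Option (β i)) → X} (hx : ∀ J i o, o ≠ J i → x J ∈ C i o) :
    ∃ F : (Option (Σ i, β i) → ℝ) → X, Continuous F ∧
      ∀ s ∈ stdSimplex ℝ (Option (Σ i, β i)),
        (∀ i b, s (some ⟨i, b⟩) = 0 → F s ∈ C i (some b)) ∧
          (s none = 0 → ∃ i, F s ∈ C i none) := by
  classical
  set N : ℝ := ((Fintype.card (Option (Σ i, β i)) : ℕ) : ℝ) with hN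
  have hN0 : 0 < N := by
    rw [hN]; exact_mod_cast Fintype.card_pos
  let clamp : ℝ → ℝ := fun t => max 0 (min 1 t)
  have hclamp : Continuous clamp := by fun_prop
  have hclamp0 : ∀ t ≤ 0, clamp t = 0 := fun t ht =>
    max_eq_left ((min_le_right _ _).trans ht)
  have hclamp1 : ∀ t, 1 ≤ t → clamp t = 1 := fun t ht => by
    simp only [clamp, min_eq_left ht]; norm_num
  have hclamp01 : ∀ t, clamp t ∈ Set.Icc (0 : ℝ) 1 := fun t =>
    ⟨le_max_left _ _, max_le zero_le_one (min_le_left _ _)⟩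
  let σ : κ → (Option (Σ i, β i) → ℝ) → ℝ := fun i s => ∑ b, s (some ⟨i, b⟩)
  -- for each `i` some weight `h i o` equals `1`; the thresholds make `h i none` vanish for the `i`
  -- whose coordinates contain a maximal coordinate of a point with `s none = 0`
  let h : ∀ i, Option (β i) → (Option (Σ i, β i) → ℝ) → ℝ := fun i o s =>
    o.elim (clamp (2 - 2 * N * σ i s)) fun b => clamp (2 * N ^ 2 * s (some ⟨i, b⟩))
  have hcont : ∀ i o, Continuous (h i o) := by
    rintro i (_ | b)
    · exact hclamp.comp (by fun_prop)
    · exact hclamp.comp (by fun_prop)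
  have h01 : ∀ i o s, h i o s ∈ Set.Icc (0 : ℝ) 1 := by
    rintro i (_ | b) s
    · exact hclamp01 _
    · exact hclamp01 _
  have hone : ∀ s i, ∃ o, h i o s = 1 := by
    intro s i
    by_cases hσ : 2 * N * σ i s ≤ 1
    · exact ⟨none, hclamp1 _ (by linarith)⟩
    · by_contra hcon
      push Not at hcon
      have hb : ∀ b, 2 * N ^ 2 * s (some ⟨i, b⟩) ≤ 1 := fun b => by
        by_contra hb
        exact hcon (some b) (hclamp1 _ (not_le.1 hb).le)
      have hcard : (Fintype.card (β i) : ℝ) ≤ N := by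
        rw [hN]
        exact_mod_cast Fintype.card_le_of_injective
          (fun b : β i => (some ⟨i, b⟩ : Option (Σ i, β i))) fun b b' hbb => by simpa using hbb
      have hsum : 2 * N ^ 2 * σ i s ≤ Fintype.card (β i) := by
        simp only [σ, Finset.mul_sum]
        exact (Finset.sum_le_sum fun b _ => hb b).trans (by simp)
      have : N * 1 < N * (2 * N * σ i s) := by gcongr; exact not_le.1 hσ
      linarith
  let c : (∀ i, Option (β i)) → (Option (Σ i, β i) → ℝ) → ℝ := fun J s => ∏ i, h i (J i) s
  obtain ⟨F, hF, hFA⟩ := exists_continuous_mem_of_isGeodConvex x (c := c)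
    (fun J => continuous_finsetProd _ fun i _ => hcont i (J i))
    (fun J s => ⟨Finset.prod_nonneg fun i _ => (h01 i _ s).1,
      Finset.prod_le_one (fun i _ => (h01 i _ s).1) fun i _ => (h01 i _ s).2⟩)
  have hmem : ∀ s i o, h i o s = 0 → F s ∈ C i o := by
    intro s i o ho
    refine hFA s ?_ _ (hC i o) fun J hJ => hx J i o fun hoJ => hJ ?_
    · choose J hJ using hone s
      exact ⟨J, Finset.prod_eq_one fun i _ => hJ i⟩
    · exact Finset.prod_eq_zero (Finset.mem_univ i) (hoJ ▸ ho)
  refine ⟨F, hF, fun s hs => ⟨fun i b hb => hmem s i _ ?_, fun hnone => ?_⟩⟩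
  · exact hclamp0 _ (by rw [hb, mul_zero])
  · obtain ⟨a, ha⟩ : ∃ a, 1 / N ≤ s a := by
      by_contra hcon
      push Not at hcon
      have h1 : ∑ a, s a < ∑ _a : Option (Σ i, β i), 1 / N :=
        Finset.sum_lt_sum_of_nonempty Finset.univ_nonempty fun a _ => hcon a
      rw [hs.2, Finset.sum_const, Finset.card_univ, nsmul_eq_mul, ← hN,
        mul_one_div_cancel hN0.ne'] at h1
      exact lt_irrefl _ h1
    rcases a with _ | ⟨i, b⟩
    · rw [hnone] at ha
      exact absurd ha (not_le.2 (by positivity))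
    · refine ⟨i, hmem s i none (hclamp0 _ ?_)⟩
      have h1 : s (some ⟨i, b⟩) ≤ σ i s :=
        Finset.single_le_sum (f := fun b => s (some ⟨i, b⟩)) (fun b _ => hs.1 _)
          (Finset.mem_univ b)
      have h2 : N * (1 / N) ≤ N * σ i s := by gcongr; exact ha.trans h1
      rw [mul_one_div_cancel hN0.ne'] at h2
      linarith

/-! ### Fixed points of commuting families -/

/-- A finite set of isometries without a common fixed point, minimal for this property. -/
theorem exists_minimal_no_common_fixedPoint {X : Type*} [MetricSpace X] {S : Set (X ≃ᵢ X)}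
    (h : ∃ T : Finset (X ≃ᵢ X), (T : Set (X ≃ᵢ X)) ⊆ S ∧ ∀ x, ∃ s ∈ T, s x ≠ x) :
    ∃ T : Finset (X ≃ᵢ X), (T : Set (X ≃ᵢ X)) ⊆ S ∧ (∀ x, ∃ s ∈ T, s x ≠ x) ∧
      ∀ T' ⊂ T, ∃ x, ∀ s ∈ T', s x = x := by
  obtain ⟨T, hT, hmin⟩ := WellFounded.has_min
    (r := ((· ⊂ ·) : Finset (X ≃ᵢ X) → Finset (X ≃ᵢ X) → Prop)) wellFounded_lt
    {T | (T : Set (X ≃ᵢ X)) ⊆ S ∧ ∀ x, ∃ s ∈ T, s x ≠ x} h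
  refine ⟨T, hT.1, hT.2, fun T' hT' => ?_⟩
  by_contra hcon
  push Not at hcon
  exact hmin T' ⟨(Finset.coe_subset.2 hT'.1).trans hT.1, hcon⟩ hT'

theorem proposition3p3 {X : Type*} [MetricSpace X] [CompleteSpace X] [Nonempty X] [IsCAT0 X]
    (n : ℕ) (k : Fin n → ℕ) (hk : ∀ i, 0 < k i)
    (hdim : coveringDim X < ((∑ i, k i : ℕ) : WithBot ℕ∞))
    (S : Fin n → Set (X ≃ᵢ X))
    (hcomm : ∀ i j, i ≠ j → ∀ s ∈ S i, ∀ t ∈ S j, Commute s t)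
    (hfix : ∀ i, ∀ T : Finset (X ≃ᵢ X), (T : Set (X ≃ᵢ X)) ⊆ S i → T.card ≤ k i →
      ∃ x : X, ∀ s ∈ T, s x = x) :
    ∃ i, ∀ T : Finset (X ≃ᵢ X), (T : Set (X ≃ᵢ X)) ⊆ S i →
      ∃ x : X, ∀ s ∈ T, s x = x := by
  classical
  by_contra hcon
  push Not at hcon
  choose T hTS hTfix hTmin using fun i => exists_minimal_no_common_fixedPoint (hcon i)
  have hcard : ∀ i, k i < (T i).card := by
    intro i
    by_contra hle
    obtain ⟨x, hx⟩ := hfix i (T i) (hTS i) (not_lt.1 hle)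
    obtain ⟨s, hs, hsx⟩ := hTfix i x
    exact hsx (hx s hs)
  have hne : ∀ i, ∃ τ, τ ∈ T i := fun i => Finset.card_pos.1 ((hk i).trans (hcard i))
  choose τ hτ using hne
  let β : Fin n → Type _ := fun i => {s // s ∈ (T i).erase (τ i)}
  let el : ∀ i, Option (β i) → X ≃ᵢ X := fun i o => o.elim (τ i) Subtype.val
  have hel_mem : ∀ i o, el i o ∈ T i := by
    rintro i (_ | b)
    · exact hτ i
    · exact Finset.mem_of_mem_erase b.2
  have hel_inj : ∀ i, Function.Injective (el i) := by
    rintro i (_ | b) (_ | b') h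
    · rfl
    · exact absurd h.symm (Finset.ne_of_mem_erase b'.2)
    · exact absurd h (Finset.ne_of_mem_erase b.2)
    · exact congrArg some (Subtype.ext h)
  -- for each choice of one member of every `T i` there is a point fixed by all other members
  have hvert : ∀ J : ∀ i, Option (β i), ∃ x : X, ∀ i,
      ∀ s ∈ (T i : Set (X ≃ᵢ X)) \ {el i (J i)}, s x = x := by
    intro J
    refine exists_common_fixedPoint (fun i j hij s hs t ht => hcomm i j hij s ?_ t ?_) fun i => ?_
    · exact hTS i hs.1
    · exact hTS j ht.1
    · obtain ⟨x, hx⟩ := hTmin i _ (Finset.erase_ssubset (hel_mem i (J i)))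
      exact ⟨x, fun s hs => hx s (Finset.mem_erase.2 ⟨hs.2, hs.1⟩)⟩
  choose x hx using hvert
  obtain ⟨F, hF, hFfix⟩ := exists_continuous_simplex_of_product
    (C := fun i o => {x : X | el i o x = x})
    (fun i o => IsometryEquiv.isGeodConvex_fixedPoints _) (x := x)
    (fun J i o ho => hx J i _ ⟨hel_mem i o, fun H => ho (hel_inj i H)⟩)
  let W : Option (Σ i, β i) → Set X := fun a =>
    a.elim {x | ∀ i, τ i x ≠ x} fun p => {x | p.2.1 x ≠ x}
  refine not_hasCoveringDimLT_of_continuous (W := W) (n := ∑ i, k i) hF ?_ ?_ ?_ ?_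
    (coveringDim_lt_iff.1 hdim)
  · have hopen : ∀ s : X ≃ᵢ X, IsOpen {x | s x ≠ x} := fun s =>
      s.isClosed_fixedPoints.isOpen_compl
    rintro (_ | p)
    · have : W none = ⋂ i, {x | τ i x ≠ x} := by ext; simp [W]
      rw [this]
      exact isOpen_iInter_of_finite fun i => hopen _
    · exact hopen _
  · refine Set.eq_univ_of_forall fun y => Set.mem_iUnion.2 ?_
    by_cases hy : ∀ i, τ i y ≠ y
    · exact ⟨none, hy⟩
    · push Not at hy
      obtain ⟨i, hi⟩ := hy
      obtain ⟨s, hs, hsy⟩ := hTfix i y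
      exact ⟨some ⟨i, ⟨s, Finset.mem_erase.2 ⟨fun H => hsy (H ▸ hi), hs⟩⟩⟩, hsy⟩
  · rintro s hs (_ | ⟨i, b⟩) hsi hW
    · obtain ⟨i, hi⟩ := (hFfix s hs).2 hsi
      exact hW i hi
    · exact hW ((hFfix s hs).1 i b hsi)
  · have hβ : ∀ i, k i ≤ Fintype.card (β i) := fun i => by
      have := hcard i
      rw [Fintype.card_coe, Finset.card_erase_of_mem (hτ i)]
      omega
    rw [Fintype.card_option, Fintype.card_sigma]
    exact Nat.lt_succ_of_le (Finset.sum_le_sum fun i _ => hβ i)
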